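/- Let $n \ge 1$. For a nonnegative $k\times k$ matrix $B=(b_{ij})$ ($k\ge 1$) let the permanental mean be $$\operatorname{pm}(B) = \left(\frac{\operatorname{per} B}{k!}\right)^{1/k}, \qquad \operatorname{per} B=\sum_{\sigma}\prod_{i=1}^k b_{i,\sigma(i)},$$ where $\sigma$ runs over all permutations of $\{1,\dots,k\}$. For a nonnegative $n\times n$ matrix $A$ let the scaling mean be $$\operatorname{sm}(A) = \frac{1}{n^2}\inf_{x,y}\frac{x^\top A y}{\operatorname{gm}(x)\operatorname{gm}(y)},$$ where $x$ and $y$ run over all vectors in $\mathbb{R}^n$ with positive entries, and $\operatorname{gm}(x)=(x_1\cdots x_n)^{1/n}$ is the geometric mean of the entries. Then for every $n\times n$ matrix $A$ with nonnegative real entries, $$\lim_{m\to\infty}\operatorname{pm}(A\otimes U_m) = \operatorname{sm}(A),$$ where $U_m$ is the $m\times m$ matrix all of whose entries are $1$ and $\otimes$ is the Kronecker product; in particular, the limit exists. -/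

import Mathlib

open scoped Kronecker Matrix Nat

noncomputable section

namespace MatrixMean

/-- The geometric mean `(∏ x_i)^(1/n)` of the entries of a vector (used for positive entries). -/
def gmean {ι : Type*} [Fintype ι] (x : ι → ℝ) : ℝ :=
  (∏ i, x i) ^ (1 / (Fintype.card ι : ℝ))

/-- The permanental mean `(per A / n!)^(1/n)` of a nonnegative `n × n` matrix. -/
def pmean {ι : Type*} [Fintype ι] [DecidableEq ι] (A : Matrix ι ι ℝ) : ℝ :=
  (A.permanent / ((Fintype.card ι)! : ℝ)) ^ (1 / (Fintype.card ι : ℝ))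

/-- The scaling mean of a nonnegative `m × n` matrix: `1/(mn)` times the infimum of
`xᵀ A y / (gmean x * gmean y)` over all vectors `x`, `y` with positive entries.
For nonnegative `A` the set below is nonempty and bounded below by `0`, so `sInf` is its
true infimum. -/
def smean {ι κ : Type*} [Fintype ι] [Fintype κ] (A : Matrix ι κ ℝ) : ℝ :=
  1 / ((Fintype.card ι : ℝ) * (Fintype.card κ : ℝ)) *
    sInf {r : ℝ | ∃ (x : ι → ℝ) (y : κ → ℝ), (∀ i, 0 < x i) ∧ (∀ j, 0 < y j) ∧
      r = (x ⬝ᵥ (A *ᵥ y)) / (gmean x * gmean y)}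

/-- The `m × m` matrix all of whose entries are `1`. -/
def allOnes (m : ℕ) : Matrix (Fin m) (Fin m) ℝ :=
  Matrix.of fun _ _ => 1

end MatrixMean

end

open scoped Kronecker Matrix Nat

namespace MatrixMean

/-! Let `n` be the size of `A` and `m` that of the block of ones. The permanent of `A ⊗ₖ J` is a sum
over permutations `π` of `ι × κ` whose terms see only first coordinates, that is, how often `π`
sends block `i` to block `j`.

Upper bound: at most `m!^n` permutations share the same column blocks. After weighting by `y`,
summing over all functions to `ι` gives `permanent_kronecker_ones_le`; AM-GM with `x`
(`prod_mulVec_le`) and Stirling turn it into `pmean_kronecker_ones_le`.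

Lower bound: keep one count matrix `K`, with all line sums `m`. It contributes at least `m!^(2n) ∏
A^K / K!`. Take `K` of maximal weight. Since no cyclic exchange of units improves it, a potential
argument (`exists_potential`, `exists_scaling`) gives positive `x`, `y` with `K ≤ A x y ≤ K + 1`
entrywise. The left inequality bounds the weight below; the right one, tested in the infimum, bounds
`smean A` above. The losses are polynomial in `m` and vanish under the `nm`-th root.

This needs a positive diagonal. Without one, Hall's theorem gives `smean A = 0`, and the upper bound
suffices. -/

/-- The product of the weights `W` along the walk that starts at `a` and visits `l` in order. -/
def walkWeight {ι : Type*} (W : ι → ι → ℝ) : ι → List ι → ℝ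
  | _, [] => 1
  | a, b :: l => W a b * walkWeight W b l

/-! ### Weighted walks and multiplicative potentials -/

section walk
variable {ι : Type*} {W : ι → ι → ℝ}

lemma walkWeight_nonneg (hW : ∀ i j, 0 ≤ W i j) (a : ι) (l : List ι) : 0 ≤ walkWeight W a l := by
  induction l generalizing a with
  | nil => simp [walkWeight]
  | cons b l ih => exact mul_nonneg (hW _ _) (ih b)

lemma walkWeight_append (a b : ι) (l l' : List ι) :
    walkWeight W a (l ++ b :: l') = walkWeight W a (l ++ [b]) * walkWeight W b l' := by
  induction l generalizing a with
  | nil => simp [walkWeight]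
  | cons c l ih => simp [walkWeight, ih c, mul_assoc]

lemma walkWeight_le_pow (hW : ∀ i j, 0 ≤ W i j) {C : ℝ} (hC : ∀ i j, W i j ≤ C) (a : ι)
    (l : List ι) : walkWeight W a l ≤ C ^ l.length := by
  induction l generalizing a with
  | nil => simp [walkWeight]
  | cons b l ih =>
    rw [walkWeight, List.length_cons, pow_succ']
    exact mul_le_mul (hC a b) (ih b) (walkWeight_nonneg hW b l) ((hW a b).trans (hC a b))

lemma walkWeight_eq_prod_map {f : ι → ι} (a c : ι) (l : List ι)
    (h : List.IsChain (fun i j => f i = j) (a :: (l ++ [c]))) :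
    walkWeight W a (l ++ [c]) = ((a :: l).map fun i => W i (f i)).prod := by
  induction l generalizing a with
  | nil => simp at h; simp [walkWeight, h]
  | cons b l ih =>
    rw [List.cons_append, List.isChain_cons_cons] at h
    rw [List.cons_append, walkWeight, ih b h.2, List.map_cons (l := b :: l), List.prod_cons, h.1]

lemma exists_split_of_not_nodup {l : List ι} (h : ¬ l.Nodup) :
    ∃ b l₁ l₂ l₃, l = l₁ ++ b :: (l₂ ++ b :: l₃) := by
  induction l with
  | nil => simp at h
  | cons a l ih =>
    by_cases ha : a ∈ l
    · obtain ⟨s, t, rfl⟩ := List.append_of_mem ha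
      exact ⟨a, [], s, t, rfl⟩
    · obtain ⟨b, l₁, l₂, l₃, rfl⟩ := ih (fun h' => h (List.nodup_cons.2 ⟨ha, h'⟩))
      exact ⟨b, a :: l₁, l₂, l₃, rfl⟩

lemma isChain_formPerm [DecidableEq ι] {a : ι} {l : List ι} (h : (a :: l).Nodup) :
    List.IsChain (fun i j => (a :: l).formPerm i = j) (a :: (l ++ [a])) := by
  rw [List.isChain_iff_getElem]
  intro i hi
  simp only [List.length_cons, List.length_append, List.length_nil] at hi
  have h1 : (a :: (l ++ [a]))[i] = (a :: l)[i]'(by simp; omega) := by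
    exact List.getElem_append_left (as := a :: l) (bs := [a]) _
  rw [h1, List.formPerm_apply_getElem _ h]
  rcases Nat.lt_or_ge (i + 1) (a :: l).length with h2 | h2
  · simp only [Nat.mod_eq_of_lt h2, List.getElem_cons_succ]
    rw [List.getElem_append_left]
  · have : i = l.length := by simp at h2; omega
    subst this
    simp

variable [Fintype ι] [DecidableEq ι]

lemma walkWeight_closed_le_one_of_nodup
    (hdiag : ∀ i, W i i ≤ 1)
    (hperm : ∀ σ : Equiv.Perm ι, ∏ i, (if σ i = i then 1 else W i (σ i)) ≤ 1)
    {a : ι} {l : List ι} (h : (a :: l).Nodup) : walkWeight W a (l ++ [a]) ≤ 1 := by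
  -- A loop needs `hdiag`: its `formPerm` is the identity, about which `hperm` says nothing.
  rcases l with _ | ⟨b, l⟩
  · simpa [walkWeight] using hdiag a
  set L := a :: b :: l with hL
  rw [walkWeight_eq_prod_map a a (b :: l) (isChain_formPerm h), ← hL,
    ← List.prod_toFinset _ h]
  refine le_of_eq_of_le ?_ (hperm L.formPerm)
  rw [← Finset.prod_subset (Finset.subset_univ L.toFinset)]
  · refine Finset.prod_congr rfl fun i hi => ?_
    rw [if_neg]
    have := (List.mem_toFinset.1 hi)
    exact (List.formPerm_apply_mem_ne_self_iff _ h _ this).2 (by simp [hL])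
  · intro i _ hi
    rw [if_pos (List.formPerm_apply_of_notMem (by simpa using hi))]

/-- A closed walk splits into simple cycles: a return to `a` factors the weight, and an inner closed
walk from `b` to `b` can be excised because its weight is at most 1. -/
lemma walkWeight_closed_le_one (hW : ∀ i j, 0 ≤ W i j) (hdiag : ∀ i, W i i ≤ 1)
    (hperm : ∀ σ : Equiv.Perm ι, ∏ i, (if σ i = i then 1 else W i (σ i)) ≤ 1)
    (a : ι) (l : List ι) : walkWeight W a (l ++ [a]) ≤ 1 := by
  induction hn : l.length using Nat.strong_induction_on generalizing a l with
  | _ n ih =>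
    by_cases hnd : (a :: l).Nodup
    · exact walkWeight_closed_le_one_of_nodup hdiag hperm hnd
    by_cases ha : a ∈ l
    · obtain ⟨s, t, rfl⟩ := List.append_of_mem ha
      simp only [List.length_append, List.length_cons] at hn
      rw [List.append_assoc, List.cons_append, walkWeight_append]
      exact mul_le_one₀ (ih s.length (by omega) a s rfl) (walkWeight_nonneg hW _ _)
        (ih t.length (by omega) a t rfl)
    · obtain ⟨b, l₁, l₂, l₃, rfl⟩ :=
        exists_split_of_not_nodup (fun h => hnd (List.nodup_cons.2 ⟨ha, h⟩))
      simp only [List.length_append, List.length_cons] at hn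
      have h1 := ih (l₁ ++ b :: l₃).length (by simp; omega) a _ rfl
      rw [List.append_assoc, List.cons_append, walkWeight_append] at h1
      simp only [List.append_assoc, List.cons_append]
      rw [walkWeight_append, walkWeight_append b b]
      have h2 := ih l₂.length (by omega) b l₂ rfl
      refine le_trans (mul_le_mul_of_nonneg_left ?_ (walkWeight_nonneg hW _ _)) h1
      exact mul_le_of_le_one_left (walkWeight_nonneg hW _ _) h2

/-- Deleting closed subwalks never lowers the weight, so walks without repetition dominate. This
makes the supremum over all walks finite. -/
lemma exists_walkWeight_le (hW : ∀ i j, 0 ≤ W i j) (hdiag : ∀ i, W i i ≤ 1)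
    (hperm : ∀ σ : Equiv.Perm ι, ∏ i, (if σ i = i then 1 else W i (σ i)) ≤ 1)
    (a : ι) (l : List ι) :
    ∃ l' : List ι, l'.length ≤ Fintype.card ι ∧ walkWeight W a l ≤ walkWeight W a l' := by
  induction hn : l.length using Nat.strong_induction_on generalizing l with
  | _ n ih =>
    by_cases hnd : l.Nodup
    · exact ⟨l, hnd.length_le_card, le_rfl⟩
    obtain ⟨b, l₁, l₂, l₃, rfl⟩ := exists_split_of_not_nodup hnd
    simp only [List.length_append, List.length_cons] at hn
    obtain ⟨l', h1, h2⟩ := ih (l₁ ++ b :: l₃).length (by simp; omega) _ rfl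
    refine ⟨l', h1, le_trans ?_ h2⟩
    rw [walkWeight_append, walkWeight_append b b, walkWeight_append (l' := l₃)]
    exact mul_le_mul_of_nonneg_left (mul_le_of_le_one_left (walkWeight_nonneg hW _ _)
      (walkWeight_closed_le_one hW hdiag hperm b l₂)) (walkWeight_nonneg hW _ _)

/-- If no permutation gains from the weights `W`, then `W` is dominated by a multiplicative
potential. -/
theorem exists_potential (hW : ∀ i j, 0 ≤ W i j) (hdiag : ∀ i, W i i ≤ 1)
    (hperm : ∀ σ : Equiv.Perm ι, ∏ i, (if σ i = i then 1 else W i (σ i)) ≤ 1) :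
    ∃ x : ι → ℝ, (∀ i, 0 < x i) ∧ ∀ i j, W i j * x j ≤ x i := by
  obtain ⟨C, hC1, hC⟩ : ∃ C : ℝ, 1 ≤ C ∧ ∀ i j, W i j ≤ C := by
    refine ⟨1 + ∑ i, ∑ j, W i j, ?_, fun i j => ?_⟩
    · have : 0 ≤ ∑ i, ∑ j, W i j := Finset.sum_nonneg fun i _ => Finset.sum_nonneg fun j _ => hW i j
      linarith
    · have h1 := Finset.single_le_sum (fun j _ => hW i j) (Finset.mem_univ j)
      have h2 := Finset.single_le_sum
        (fun i _ => Finset.sum_nonneg fun j (_ : j ∈ Finset.univ) => hW i j) (Finset.mem_univ i)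
      linarith
  have hb : ∀ a, BddAbove (Set.range (walkWeight W a)) := by
    refine fun a => ⟨C ^ Fintype.card ι, ?_⟩
    rintro _ ⟨l, rfl⟩
    obtain ⟨l', h1, h2⟩ := exists_walkWeight_le hW hdiag hperm a l
    exact h2.trans ((walkWeight_le_pow hW hC a l').trans (pow_le_pow_right₀ hC1 h1))
  -- The potential is the best weight of a walk from `a`: the empty walk makes it at least 1, and
  -- prefixing the edge from `i` to `j` gives the inequality.
  refine ⟨fun a => ⨆ l, walkWeight W a l, fun i => ?_, fun i j => ?_⟩
  · exact lt_of_lt_of_le one_pos (le_ciSup (hb i) [])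
  · rw [Real.mul_iSup_of_nonneg (hW i j)]
    exact ciSup_le fun l => le_ciSup (hb i) (j :: l)

end walk

/-! ### Counting permutations by their block pattern -/

section count
variable {ι κ : Type*} [Fintype ι] [DecidableEq ι] [Fintype κ]

/-- The number of entries of the `(i, j)` block that are selected by the permutation `π`. -/
def blockCount (π : Equiv.Perm (ι × κ)) (i j : ι) : ℕ :=
  Fintype.card {s : κ // (π (i, s)).1 = j}

lemma permanent_kronecker_ones [DecidableEq κ] (A : Matrix ι ι ℝ) (J : Matrix κ κ ℝ)
    (hJ : ∀ s t, J s t = 1) : (A ⊗ₖ J).permanent = ∑ π : Equiv.Perm (ι × κ), ∏ p, A p.1 (π p).1 := by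
  -- `Matrix.permanent` permutes the row index; transposing moves the permutation to the columns.
  rw [← Matrix.permanent_transpose, Matrix.permanent]
  simp [Matrix.kroneckerMap_apply, hJ]

lemma prod_eq_prod_pow_blockCount (A : Matrix ι ι ℝ) (π : Equiv.Perm (ι × κ)) :
    ∏ p, A p.1 (π p).1 = ∏ i, ∏ j, A i j ^ blockCount π i j := by
  rw [Fintype.prod_prod_type]
  refine Finset.prod_congr rfl fun i _ => ?_
  rw [← Finset.prod_fiberwise Finset.univ (fun s => (π (i, s)).1)]
  refine Finset.prod_congr rfl fun j _ => ?_
  rw [blockCount, Fintype.card_subtype]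
  refine Finset.prod_eq_pow_card fun s hs => ?_
  rw [(Finset.mem_filter.1 hs).2]

/-- Cut the copy of `κ` in row `i` into pieces of sizes `K i j`, do the same in each column, and
match the pieces labelled `(i, j)`. -/
lemma exists_perm_blockCount_eq {K : ι → ι → ℕ} (hrow : ∀ i, ∑ j, K i j = Fintype.card κ)
    (hcol : ∀ j, ∑ i, K i j = Fintype.card κ) :
    ∃ π : Equiv.Perm (ι × κ), ∀ i j, blockCount π i j = K i j := by
  have er : ∀ i, Nonempty (κ ≃ Σ j, Fin (K i j)) := fun i =>
    ⟨Fintype.equivOfCardEq (by simp [hrow])⟩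
  have ec : ∀ j, Nonempty ((Σ i, Fin (K i j)) ≃ κ) := fun j =>
    ⟨Fintype.equivOfCardEq (by simp [hcol])⟩
  let sw : (Σ i, Σ j, Fin (K i j)) ≃ Σ j, Σ i, Fin (K i j) :=
    ⟨fun t => ⟨t.2.1, t.1, t.2.2⟩, fun t => ⟨t.2.1, t.1, t.2.2⟩, fun _ => rfl, fun _ => rfl⟩
  refine ⟨(Equiv.sigmaEquivProd ι κ).symm.trans <|
    (Equiv.sigmaCongrRight fun i => (er i).some).trans <| sw.trans <|
    (Equiv.sigmaCongrRight fun j => (ec j).some).trans (Equiv.sigmaEquivProd ι κ), fun i j => ?_⟩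
  rw [← Fintype.card_fin (K i j), blockCount]
  exact Fintype.card_congr (((er i).some.subtypeEquiv fun s => Iff.rfl).trans
    (Equiv.sigmaSubtype j))

variable [DecidableEq κ]

lemma card_perm_fst_comp :
    Fintype.card {g : Equiv.Perm (ι × κ) // Prod.fst ∘ g = (Prod.fst : ι × κ → ι)} =
      (Fintype.card κ)! ^ Fintype.card ι := by
  rw [DomMulAct.stabilizer_card, Finset.prod_congr rfl, Finset.prod_const, Finset.card_univ]
  intro i _
  congr 1
  refine Fintype.card_congr ⟨fun p => p.1.2, fun s => ⟨(i, s), rfl⟩, ?_, fun s => rfl⟩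
  rintro ⟨⟨j, s⟩, rfl⟩
  rfl

lemma card_perm_fst_comp_eq_le (f : ι × κ → ι) :
    (Finset.univ.filter fun π : Equiv.Perm (ι × κ) => Prod.fst ∘ π = f).card ≤
      (Fintype.card κ)! ^ Fintype.card ι := by
  rcases (Finset.univ.filter fun π : Equiv.Perm (ι × κ) => Prod.fst ∘ π = f).eq_empty_or_nonempty
    with h | ⟨π₀, h⟩
  · simp [h]
  · rw [← card_perm_fst_comp, Fintype.card_subtype]
    have h0 := (Finset.mem_filter.1 h).2
    refine Finset.card_le_card_of_injOn (fun π => π * π₀⁻¹) (fun π hπ => ?_)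
      fun a _ b _ hab => mul_right_cancel hab
    have h1 := (Finset.mem_filter.1 hπ).2
    simp only [Finset.coe_filter, Finset.mem_univ, true_and, Set.mem_ofPred_eq]
    funext p
    have h2 := congrFun (h1.trans h0.symm) (π₀⁻¹ p)
    simpa using h2

theorem permanent_kronecker_ones_le {A : Matrix ι ι ℝ} (hA : ∀ i j, 0 ≤ A i j)
    {J : Matrix κ κ ℝ} (hJ : ∀ s t, J s t = 1) {y : ι → ℝ} (hy : ∀ j, 0 < y j) :
    (A ⊗ₖ J).permanent * (∏ j, y j) ^ Fintype.card κ ≤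
      ((Fintype.card κ)! : ℝ) ^ Fintype.card ι * (∏ i, (A *ᵥ y) i) ^ Fintype.card κ := by
  have hprod : ∀ z : ι → ℝ, ∏ p : ι × κ, z p.1 = (∏ j, z j) ^ Fintype.card κ := fun z => by
    rw [Fintype.prod_prod_type]
    simp [Finset.prod_pow]
  rw [permanent_kronecker_ones A J hJ, Finset.sum_mul,
    ← Finset.sum_fiberwise Finset.univ (fun π : Equiv.Perm (ι × κ) => Prod.fst ∘ π)]
  -- Relaxing to all functions `f`, whether or not they come from a permutation, makes the sum
  -- factor over `p`.
  calc _ ≤ ∑ f : ι × κ → ι, ((Fintype.card κ)! : ℝ) ^ Fintype.card ι *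
        ∏ p, A p.1 (f p) * y (f p) := ?_
    _ = _ := by
      have h := Finset.prod_univ_sum (fun _ : ι × κ => (Finset.univ : Finset ι))
        (fun p j => A p.1 j * y j)
      rw [Fintype.piFinset_univ] at h
      rw [← Finset.mul_sum, ← h, ← hprod]
      rfl
  refine Finset.sum_le_sum fun f _ => ?_
  have h : ∀ π ∈ Finset.univ.filter (fun π : Equiv.Perm (ι × κ) => Prod.fst ∘ π = f),
      (∏ p, A p.1 (π p).1) * (∏ j, y j) ^ Fintype.card κ = ∏ p, A p.1 (f p) * y (f p) := by
    intro π hπ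
    have hf : ∀ p, (π p).1 = f p := congrFun (Finset.mem_filter.1 hπ).2
    rw [← hprod, ← Equiv.prod_comp π (fun p => y p.1), ← Finset.prod_mul_distrib]
    exact Finset.prod_congr rfl fun p _ => by rw [hf]
  rw [Finset.sum_congr rfl h, Finset.sum_const, nsmul_eq_mul]
  refine mul_le_mul_of_nonneg_right (by exact_mod_cast card_perm_fst_comp_eq_le f)
    (Finset.prod_nonneg fun p _ => mul_nonneg (hA _ _) (hy _).le)

/-- Orbit counting: pairs of block-preserving permutations act by `h * π₀ * g⁻¹` without changing
the product. Each fibre of this map embeds in the stabilizer of the row and column block labels,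
whose order is the product of the factorials. -/
lemma card_sq_le_prod_blockCount_factorial_mul (A : Matrix ι ι ℝ) (π₀ : Equiv.Perm (ι × κ)) :
    ((Fintype.card κ)! ^ Fintype.card ι) ^ 2 ≤ (∏ i, ∏ j, (blockCount π₀ i j)!) *
      (Finset.univ.filter fun π : Equiv.Perm (ι × κ) =>
        ∏ p : ι × κ, A p.1 (π p).1 = ∏ p : ι × κ, A p.1 (π₀ p).1).card := by
  let S := {g : Equiv.Perm (ι × κ) // Prod.fst ∘ g = (Prod.fst : ι × κ → ι)}
  have hS : ∀ (g : S) p, (g.1 p).1 = p.1 := fun g => congrFun g.2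
  let F : ι × κ → ι × ι := fun p => (p.1, (π₀ p).1)
  have hF : Fintype.card {g : Equiv.Perm (ι × κ) // F ∘ g = F} =
      ∏ i, ∏ j, (blockCount π₀ i j)! := by
    rw [DomMulAct.stabilizer_card, Fintype.prod_prod_type]
    refine Finset.prod_congr rfl fun i _ => Finset.prod_congr rfl fun j _ => ?_
    congr 1
    refine Fintype.card_congr ⟨fun p => ⟨p.1.2, ?_⟩, fun s => ⟨(i, s.1), ?_⟩, ?_, fun s => rfl⟩
    · have h1 : p.1.1 = i := congrArg Prod.fst p.2
      have h2 : (π₀ p.1).1 = j := congrArg Prod.snd p.2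
      rwa [show p.1 = (i, p.1.2) from Prod.ext h1 rfl] at h2
    · simp [F, s.2]
    · rintro ⟨⟨a, s⟩, h⟩
      simp only [F, Prod.mk.injEq] at h
      obtain ⟨rfl, h⟩ := h
      rfl
  have hcard : (Finset.univ : Finset (S × S)).card =
      ((Fintype.card κ)! ^ Fintype.card ι) ^ 2 := by
    rw [Finset.card_univ, Fintype.card_prod, card_perm_fst_comp, sq]
  rw [← hcard, ← hF]
  refine Finset.card_le_mul_card_image_of_maps_to
    (f := fun q : S × S => q.2.1 * π₀ * q.1.1⁻¹) (fun q _ => ?_) _ (fun π₁ _ => ?_)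
  · refine Finset.mem_filter.2 ⟨Finset.mem_univ _, ?_⟩
    rw [← Equiv.prod_comp q.1.1]
    refine Finset.prod_congr rfl fun p _ => ?_
    simp [hS]
  · rcases (Finset.univ.filter fun q : S × S => q.2.1 * π₀ * q.1.1⁻¹ = π₁).eq_empty_or_nonempty
      with h | ⟨q₀, h⟩
    · simp [h]
    have h0 := (Finset.mem_filter.1 h).2
    rw [Fintype.card_subtype]
    refine Finset.card_le_card_of_injOn (fun q => q₀.1.1⁻¹ * q.1.1) (fun q hq => ?_) ?_
    · have h1 := (Finset.mem_filter.1 (Finset.mem_coe.1 hq)).2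
      simp only [Finset.coe_filter, Finset.mem_univ, true_and, Set.mem_ofPred_eq]
      have h2 : ∀ p, q₀.2.1 (π₀ (q₀.1.1⁻¹ (q.1.1 p))) = q.2.1 (π₀ p) := fun p => by
        have := congrArg (fun τ : Equiv.Perm (ι × κ) => τ (q.1.1 p)) (h0.trans h1.symm)
        simpa using this
      funext p
      refine Prod.ext ?_ ?_
      · have := hS q₀.1 (q₀.1.1⁻¹ (q.1.1 p))
        rw [show q₀.1.1 (q₀.1.1⁻¹ (q.1.1 p)) = q.1.1 p from Equiv.apply_symm_apply _ _, hS] at this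
        exact this.symm
      · have := congrArg Prod.fst (h2 p)
        rw [hS, hS] at this
        exact this
    · intro q hq q' hq' hqq
      have h1 := (Finset.mem_filter.1 (Finset.mem_coe.1 hq)).2
      have h1' := (Finset.mem_filter.1 (Finset.mem_coe.1 hq')).2
      have h2 : q.1.1 = q'.1.1 := mul_left_cancel hqq
      have h3 := h1.trans h1'.symm
      rw [h2] at h3
      exact Prod.ext (Subtype.ext h2) (Subtype.ext (mul_right_cancel (mul_right_cancel h3)))

lemma le_permanent_kronecker_ones_of_perm {A : Matrix ι ι ℝ} (hA : ∀ i j, 0 ≤ A i j)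
    {J : Matrix κ κ ℝ} (hJ : ∀ s t, J s t = 1) (π₀ : Equiv.Perm (ι × κ)) :
    (((Fintype.card κ)! : ℝ) ^ Fintype.card ι) ^ 2 *
      ∏ i, ∏ j, A i j ^ blockCount π₀ i j / (blockCount π₀ i j)! ≤ (A ⊗ₖ J).permanent := by
  have h1 : (((Fintype.card κ)! : ℝ) ^ Fintype.card ι) ^ 2 ≤
      (∏ i, ∏ j, ((blockCount π₀ i j)! : ℝ)) *
      (Finset.univ.filter fun π : Equiv.Perm (ι × κ) =>
        ∏ p : ι × κ, A p.1 (π p).1 = ∏ p : ι × κ, A p.1 (π₀ p).1).card := by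
    exact_mod_cast card_sq_le_prod_blockCount_factorial_mul A π₀
  have hpos : (0 : ℝ) < ∏ i, ∏ j, ((blockCount π₀ i j)! : ℝ) :=
    Finset.prod_pos fun i _ => Finset.prod_pos fun j _ => by positivity
  have hw : (0 : ℝ) ≤ ∏ i, ∏ j, A i j ^ blockCount π₀ i j :=
    Finset.prod_nonneg fun i _ => Finset.prod_nonneg fun j _ => pow_nonneg (hA i j) _
  simp only [Finset.prod_div_distrib]
  rw [mul_div_assoc', div_le_iff₀ hpos, mul_comm (Matrix.permanent _)]
  refine (mul_le_mul_of_nonneg_right h1 hw).trans ?_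
  rw [mul_assoc]
  refine mul_le_mul_of_nonneg_left ?_ hpos.le
  rw [permanent_kronecker_ones A J hJ, ← prod_eq_prod_pow_blockCount, ← nsmul_eq_mul,
    ← Finset.sum_const]
  rw [Finset.sum_congr rfl fun π hπ => ((Finset.mem_filter.1 hπ).2).symm]
  exact Finset.sum_le_sum_of_subset_of_nonneg (Finset.filter_subset _ _)
    fun π _ _ => Finset.prod_nonneg fun p _ => hA _ _

end count

/-! ### Multiplicity matrices of maximal weight -/

section exchange
variable {ι : Type*} [Fintype ι]

/-- The weight `∏ A i j ^ K i j / (K i j)!` of a matrix `K` of multiplicities. -/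
noncomputable def multiplicityWeight (A : Matrix ι ι ℝ) (K : ι → ι → ℕ) : ℝ :=
  ∏ i, ∏ j, A i j ^ K i j / (K i j)!

/-- The square matrices of natural numbers all of whose row and column sums are `m`. -/
def lineSumMatrices (ι : Type*) [Fintype ι] (m : ℕ) : Set (ι → ι → ℕ) :=
  {K | (∀ i, ∑ j, K i j = m) ∧ ∀ j, ∑ i, K i j = m}

variable [DecidableEq ι]

lemma exists_isMaxOn_multiplicityWeight {A : Matrix ι ι ℝ} {τ : Equiv.Perm ι}
    (hτ : ∀ i, 0 < A i (τ i)) (m : ℕ) :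
    ∃ K ∈ lineSumMatrices ι m, 0 < multiplicityWeight A K ∧
      ∀ K' ∈ lineSumMatrices ι m, multiplicityWeight A K' ≤ multiplicityWeight A K := by
  have hfin : (lineSumMatrices ι m).Finite := by
    refine (Set.finite_Icc (0 : ι → ι → ℕ) (fun _ _ => m)).subset fun K hK => ?_
    refine ⟨fun _ _ => Nat.zero_le _, fun i j => ?_⟩
    rw [← hK.1 i]
    exact Finset.single_le_sum (f := K i) (fun _ _ => Nat.zero_le _) (Finset.mem_univ j)
  let K₀ : ι → ι → ℕ := fun i j => if τ i = j then m else 0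
  have hK₀ : K₀ ∈ lineSumMatrices ι m := by
    refine ⟨fun i => by simp [K₀], fun j => ?_⟩
    rw [← Equiv.sum_comp τ.symm]
    simp [K₀]
  obtain ⟨K, hK, hmax⟩ := Set.exists_max_image _ (multiplicityWeight A) hfin ⟨K₀, hK₀⟩
  refine ⟨K, hK, lt_of_lt_of_le ?_ (hmax K₀ hK₀), hmax⟩
  refine Finset.prod_pos fun i _ => Finset.prod_pos fun j _ => div_pos ?_ (by positivity)
  by_cases h : τ i = j
  · subst h; exact pow_pos (hτ i) _
  · simp [K₀, h]

lemma pow_succ_div_factorial (a : ℝ) (k : ℕ) :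
    a ^ (k + 1) / ((k + 1)! : ℝ) = a ^ k / (k ! : ℝ) * (a / (k + 1)) := by
  rw [Nat.factorial_succ]
  push_cast
  field_simp
  ring

lemma pow_div_factorial_eq {a : ℝ} (ha : a ≠ 0) (k : ℕ) :
    a ^ k / (k ! : ℝ) = a ^ (k + 1) / ((k + 1)! : ℝ) * ((k + 1 : ℕ) / a) := by
  rw [pow_succ_div_factorial]
  push_cast
  field_simp

/-- Moving one unit from the column `d` to the column `c` of a row. -/
lemma row_exchange {a : ι → ℝ} {k k' : ι → ℕ} {c d : ι}
    (hk : ∀ j, k' j + (if j = d then 1 else 0) = k j + (if j = c then 1 else 0))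
    (ha : 0 < a d) (hw : 0 ≤ ∏ j, a j ^ k j / (k j)!) :
    (∏ j, a j ^ k j / (k j)!) * (a c / (k c + 1) * (k d / a d)) ≤
      ∏ j, a j ^ k' j / ((k' j)! : ℝ) := by
  by_cases hcd : c = d
  · subst hcd
    have : k' = k := funext fun j => by have := hk j; omega
    rw [this]
    -- Nothing moves here, and the factor `k / (k + 1)` is why only an inequality is claimed.
    refine mul_le_of_le_one_right hw ?_
    have : a c / (k c + 1) * (k c / a c) = k c / (k c + 1) := by field_simp
    rw [this, div_le_one (by positivity)]
    linarith
  · refine le_of_eq ?_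
    have hterm : ∀ j, a j ^ k' j / ((k' j)! : ℝ) = a j ^ k j / ((k j)! : ℝ) *
        ((if j = c then a j / (k j + 1) else 1) * (if j = d then k j / a j else 1)) := by
      intro j
      have h := hk j
      by_cases hc : j = c
      · simp only [hc, if_true] at h ⊢
        simp only [if_neg hcd, Nat.add_zero, mul_one] at h ⊢
        rw [h, pow_succ_div_factorial]
      · by_cases hd : j = d
        · simp only [if_neg hc, if_pos hd, Nat.add_zero, one_mul] at h ⊢
          rw [← h]
          exact pow_div_factorial_eq (hd ▸ ha.ne') _
        · simp only [if_neg hc, if_neg hd, Nat.add_zero, mul_one] at h ⊢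
          rw [h]
    rw [Finset.prod_congr rfl fun j _ => hterm j, Finset.prod_mul_distrib,
      Finset.prod_mul_distrib]
    simp

/-- In column `c i`, row `i` gains a unit and row `σ i` loses one, so all line sums survive. The
product is at most the factor by which the weight changes, hence at most 1 by maximality. -/
lemma exchange_le_one {A : Matrix ι ι ℝ} (hA : ∀ i j, 0 ≤ A i j) {m : ℕ} {K : ι → ι → ℕ}
    (hK : K ∈ lineSumMatrices ι m) (hpos : 0 < multiplicityWeight A K)
    (hmax : ∀ K' ∈ lineSumMatrices ι m, multiplicityWeight A K' ≤ multiplicityWeight A K)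
    (hsupp : ∀ i j, 0 < K i j → 0 < A i j)
    (σ : Equiv.Perm ι) (c : ι → ι) (hc : ∀ i, σ i ≠ i → 0 < K (σ i) (c i)) :
    ∏ i, (if σ i = i then 1 else A i (c i) / (K i (c i) + 1) * (K (σ i) (c i) / A (σ i) (c i)))
      ≤ 1 := by
  -- `d i` is the column in which row `i` loses its unit.
  set d : ι → ι := fun i => c (σ.symm i) with hd
  have hcd : ∀ i, σ i = i → d i = c i := fun i hi => by
    rw [hd]; simp only; rw [σ.symm_apply_eq.2 hi.symm]
  have hKd : ∀ i, σ i ≠ i → 0 < K i (d i) := fun i hi => by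
    have := hc (σ.symm i) fun h => hi (by
      rw [σ.apply_symm_apply] at h
      exact (σ.symm_apply_eq.1 h.symm).symm)
    rwa [σ.apply_symm_apply] at this
  set K' : ι → ι → ℕ := fun i j =>
    K i j + (if j = c i then 1 else 0) - (if j = d i then 1 else 0) with hK'
  have hkk : ∀ i j, K' i j + (if j = d i then 1 else 0) = K i j + (if j = c i then 1 else 0) := by
    intro i j
    refine Nat.sub_add_cancel ?_
    by_cases hi : σ i = i
    · rw [hcd i hi]; exact Nat.le_add_left _ _
    · have := hKd i hi
      by_cases hj : j = d i
      · subst hj; rw [if_pos rfl]; omega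
      · rw [if_neg hj]; omega
  have hmem : K' ∈ lineSumMatrices ι m := by
    refine ⟨fun i => ?_, fun j => ?_⟩
    · have h := Finset.sum_congr (rfl : Finset.univ = Finset.univ) fun j _ => hkk i j
      rw [Finset.sum_add_distrib, Finset.sum_add_distrib, hK.1 i] at h
      simpa using h
    · have h := Finset.sum_congr (rfl : Finset.univ = Finset.univ) fun i _ => hkk i j
      rw [Finset.sum_add_distrib, Finset.sum_add_distrib, hK.2 j,
        ← Equiv.sum_comp σ (fun i => if j = d i then 1 else 0)] at h
      simpa [hd] using h
  have hrow0 : ∀ i, 0 ≤ ∏ j, A i j ^ K i j / ((K i j)! : ℝ) := fun i =>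
    Finset.prod_nonneg fun j _ => div_nonneg (pow_nonneg (hA i j) _) (Nat.cast_nonneg _)
  set g : ι → ℝ := fun i =>
    (if σ i = i then 1 else A i (c i) / (K i (c i) + 1)) *
      (if σ i = i then 1 else K i (d i) / A i (d i)) with hg
  have hrow : ∀ i, (∏ j, A i j ^ K i j / ((K i j)! : ℝ)) * g i ≤
      ∏ j, A i j ^ K' i j / ((K' i j)! : ℝ) := by
    intro i
    by_cases hi : σ i = i
    · have : K' i = K i := funext fun j => by
        have := hkk i j
        rw [hcd i hi] at this
        omega
      simp only [hg, if_pos hi, mul_one, this, le_refl]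
    · simp only [hg, if_neg hi]
      exact row_exchange (hkk i) (hsupp _ _ (hKd i hi)) (hrow0 i)
  have hg0 : ∀ i, 0 ≤ g i := fun i => by
    have h1 := hA i (c i)
    have h2 := hA i (d i)
    simp only [hg]
    split_ifs <;> positivity
  have hle : multiplicityWeight A K * ∏ i, g i ≤ multiplicityWeight A K := by
    refine le_trans ?_ (hmax K' hmem)
    rw [multiplicityWeight, ← Finset.prod_mul_distrib]
    exact Finset.prod_le_prod (fun i _ => mul_nonneg (hrow0 i) (hg0 i)) fun i _ => hrow i
  have hone : ∏ i, g i ≤ 1 := (mul_le_iff_le_one_right hpos).1 hle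
  refine le_of_eq_of_le ?_ hone
  rw [hg, Finset.prod_mul_distrib,
    ← Equiv.prod_comp σ (fun i => if σ i = i then 1 else (K i (d i) : ℝ) / A i (d i)),
    ← Finset.prod_mul_distrib]
  refine Finset.prod_congr rfl fun i _ => ?_
  simp only [hd, Equiv.symm_apply_apply, EmbeddingLike.apply_eq_iff_eq]
  split_ifs <;> simp

/-- A matrix of multiplicities of maximal weight is a scaling of `A` up to rounding. -/
theorem exists_scaling [Nonempty ι] {A : Matrix ι ι ℝ} (hA : ∀ i j, 0 ≤ A i j) {m : ℕ}
    (hm : 0 < m) {K : ι → ι → ℕ}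
    (hK : K ∈ lineSumMatrices ι m) (hpos : 0 < multiplicityWeight A K)
    (hmax : ∀ K' ∈ lineSumMatrices ι m, multiplicityWeight A K' ≤ multiplicityWeight A K) :
    ∃ x y : ι → ℝ, (∀ i, 0 < x i) ∧ (∀ j, 0 < y j) ∧
      ∀ i j, (K i j : ℝ) ≤ A i j * x i * y j ∧ A i j * x i * y j ≤ K i j + 1 := by
  have hsupp : ∀ i j, 0 < K i j → 0 < A i j := by
    intro i j hij
    refine lt_of_le_of_ne (hA i j) fun h => hpos.ne' ?_
    refine Finset.prod_eq_zero (Finset.mem_univ i) (Finset.prod_eq_zero (Finset.mem_univ j) ?_)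
    rw [← h, zero_pow hij.ne', zero_div]
  set U : ι → ι → ℝ := fun i j => A i j / (K i j + 1) with hU
  set D : ι → ι → ℝ := fun i j => K i j / A i j with hD
  have hU0 : ∀ i j, 0 ≤ U i j := fun i j => div_nonneg (hA i j) (by positivity)
  have hD0 : ∀ i j, 0 ≤ D i j := fun i j => div_nonneg (by positivity) (hA i j)
  -- The best factor, over all columns, for a unit gained by row `i` and lost by row `i'`.
  set W : ι → ι → ℝ := fun i i' => ⨆ j, U i j * D i' j with hW
  have hUW : ∀ i i' j, U i j * D i' j ≤ W i i' := fun i i' j =>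
    le_ciSup (f := fun j => U i j * D i' j) (Set.finite_range _).bddAbove j
  have hW0 : ∀ i i', 0 ≤ W i i' := fun i i' =>
    Real.iSup_nonneg fun j => mul_nonneg (hU0 _ _) (hD0 _ _)
  obtain ⟨x, hx, hWx⟩ := exists_potential hW0
    (fun i => ciSup_le fun j => by
      rcases (hA i j).eq_or_lt with h | h
      · simp [hU, ← h]
      · have : U i j * D i j = K i j / (K i j + 1) := by
          simp only [hU, hD]; field_simp
        rw [this, div_le_one (by positivity)]
        linarith)
    (fun σ => by
      choose c hc using fun i => exists_eq_ciSup_of_finite (f := fun j => U i j * D (σ i) j)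
      -- If no factor vanishes, every optimal column has a unit to give up, as `exchange_le_one`
      -- requires.
      by_cases h : ∃ i, σ i ≠ i ∧ W i (σ i) = 0
      · obtain ⟨i, h1, h2⟩ := h
        rw [Finset.prod_eq_zero (Finset.mem_univ i) (by rw [if_neg h1, h2])]
        exact zero_le_one
      · push Not at h
        have := exchange_le_one hA hK hpos hmax hsupp σ c (fun i hi => by
          have h1 := h i hi
          rw [hW] at h1
          simp only at h1
          rw [← hc i] at h1
          refine Nat.pos_of_ne_zero fun h0 => h1 ?_
          simp [hD, h0])
        refine le_of_eq_of_le (Finset.prod_congr rfl fun i _ => ?_) this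
        split_ifs with hi
        · rfl
        · exact (hc i).symm)
  -- The least `y` with `D i j * x i ≤ y j`; the potential inequality is exactly what yields `U i j
  -- * y j ≤ x i`.
  set y : ι → ℝ := fun j => ⨆ i, D i j * x i with hy
  have hDy : ∀ i j, D i j * x i ≤ y j := fun i j =>
    le_ciSup (f := fun i => D i j * x i) (Set.finite_range _).bddAbove i
  have hUy : ∀ i j, U i j * y j ≤ x i := fun i j => by
    rw [hy]
    simp only
    rw [Real.mul_iSup_of_nonneg (hU0 i j)]
    refine ciSup_le fun i' => ?_
    rw [← mul_assoc]
    exact (mul_le_mul_of_nonneg_right (hUW i i' j) (hx i').le).trans (hWx i i')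
  refine ⟨fun i => (x i)⁻¹, y, fun i => inv_pos.2 (hx i), fun j => ?_, fun i j => ⟨?_, ?_⟩⟩
  · obtain ⟨i, -, hi⟩ : ∃ i ∈ Finset.univ, K i j ≠ 0 := by
      refine Finset.exists_ne_zero_of_sum_ne_zero ?_
      rw [hK.2 j]
      exact hm.ne'
    have hi' := Nat.pos_of_ne_zero hi
    refine lt_of_lt_of_le (mul_pos (div_pos (by exact_mod_cast hi') (hsupp i j hi')) (hx i))
      (hDy i j)
  · have h := hDy i j
    rcases Nat.eq_zero_or_pos (K i j) with h0 | h0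
    · have : 0 ≤ y j := Real.iSup_nonneg fun i => mul_nonneg (hD0 i j) (hx i).le
      rw [h0]
      have := hA i j
      have := (inv_pos.2 (hx i)).le
      push_cast
      positivity
    · have ha := hsupp i j h0
      have hxi := hx i
      simp only [hD] at h
      rw [div_mul_eq_mul_div, div_le_iff₀ ha] at h
      rw [← div_eq_mul_inv, div_mul_eq_mul_div, le_div_iff₀ hxi]
      linarith
  · have h := hUy i j
    have hxi := hx i
    simp only [hU] at h
    rw [div_mul_eq_mul_div, div_le_iff₀ (by positivity)] at h
    rw [← div_eq_mul_inv, div_mul_eq_mul_div, div_le_iff₀ hxi]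
    linarith

end exchange

/-! ### Elementary Stirling bounds -/

lemma pow_le_factorial_mul_exp (k : ℕ) : (k : ℝ) ^ k ≤ k ! * Real.exp 1 ^ k := by
  have h := Real.pow_div_factorial_le_exp (k : ℝ) (Nat.cast_nonneg k) k
  rw [div_le_iff₀ (by positivity)] at h
  rwa [← Real.exp_nat_mul, mul_one, mul_comm]

lemma exp_mul_pow_le (k : ℕ) :
    Real.exp 1 * (k : ℝ) ^ (k + 1) ≤ ((k : ℝ) + 1) ^ (k + 1) := by
  have h := Real.one_sub_div_pow_le_exp_neg (n := k + 1) (t := 1) (by simp)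
  have h1 : (1 - 1 / ((k + 1 : ℕ) : ℝ)) = k / (k + 1) := by push_cast; field_simp; ring
  rw [h1, div_pow, div_le_iff₀ (by positivity), Real.exp_neg] at h
  calc Real.exp 1 * (k : ℝ) ^ (k + 1)
      ≤ Real.exp 1 * ((Real.exp 1)⁻¹ * ((k : ℝ) + 1) ^ (k + 1)) := by gcongr
    _ = _ := by field_simp

lemma factorial_mul_exp_le (k : ℕ) :
    (k ! : ℝ) * Real.exp 1 ^ k ≤ Real.exp 1 * (k + 1) * (k : ℝ) ^ k := by
  have he := Real.exp_pos 1
  -- The shifted claim has the smaller factor `k + 1`, which merges with the power so that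
  -- `exp_mul_pow_le` closes the induction.
  suffices h : ∀ k : ℕ, ((k + 1)! : ℝ) * Real.exp 1 ^ (k + 1) ≤
      Real.exp 1 * (k + 1) * ((k : ℝ) + 1) ^ (k + 1) by
    rcases k with _ | k
    · simp
    · refine (h k).trans ?_
      push_cast
      gcongr
      linarith
  intro k
  induction k with
  | zero => simp
  | succ k ih =>
    rw [Nat.factorial_succ, pow_succ]
    have h := exp_mul_pow_le (k + 1)
    push_cast at h ⊢
    calc ((k : ℝ) + 1 + 1) * ((k + 1)!) * (Real.exp 1 ^ (k + 1) * Real.exp 1)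
        = ((k + 1)! * Real.exp 1 ^ (k + 1)) * (((k : ℝ) + 1 + 1) * Real.exp 1) := by ring
      _ ≤ (Real.exp 1 * (k + 1) * ((k : ℝ) + 1) ^ (k + 1)) * (((k : ℝ) + 1 + 1) * Real.exp 1) := by
          gcongr
      _ = (Real.exp 1 * (((k : ℝ) + 1) ^ (k + 1 + 1))) * (((k : ℝ) + 1 + 1) * Real.exp 1) := by
          ring
      _ ≤ (((k : ℝ) + 1 + 1) ^ (k + 1 + 1)) * (((k : ℝ) + 1 + 1) * Real.exp 1) := by gcongr
      _ = _ := by ring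

/-! ### Geometric, scaling and permanental means -/

section means
variable {ι : Type*} [Fintype ι]

lemma gmean_pos {x : ι → ℝ} (hx : ∀ i, 0 < x i) : 0 < gmean x :=
  Real.rpow_pos_of_pos (Finset.prod_pos fun i _ => hx i) _

lemma gmean_pow [Nonempty ι] {x : ι → ℝ} (hx : ∀ i, 0 < x i) :
    gmean x ^ Fintype.card ι = ∏ i, x i := by
  rw [gmean, one_div, Real.rpow_inv_natCast_pow (Finset.prod_nonneg fun i _ => (hx i).le)
    Fintype.card_ne_zero]

lemma card_mul_gmean_le_sum [Nonempty ι] {z : ι → ℝ} (hz : ∀ i, 0 ≤ z i) :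
    (Fintype.card ι : ℝ) * gmean z ≤ ∑ i, z i := by
  have hn : (0 : ℝ) < Fintype.card ι := by exact_mod_cast Fintype.card_pos
  have h := Real.geom_mean_le_arith_mean_weighted Finset.univ
    (fun _ : ι => 1 / (Fintype.card ι : ℝ)) z (fun _ _ => by positivity)
    (by simp) (fun i _ => hz i)
  rw [Real.finsetProd_rpow _ _ (fun i _ => hz i), ← Finset.mul_sum] at h
  rw [gmean]
  calc _ ≤ (Fintype.card ι : ℝ) * (1 / (Fintype.card ι : ℝ) * ∑ i, z i) := by gcongr
    _ = _ := by field_simp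

lemma smean_nonneg {A : Matrix ι ι ℝ} (hA : ∀ i j, 0 ≤ A i j) : 0 ≤ smean A := by
  refine mul_nonneg (by positivity) (Real.sInf_nonneg ?_)
  rintro _ ⟨x, y, hx, hy, rfl⟩
  refine div_nonneg (Finset.sum_nonneg fun i _ => mul_nonneg (hx i).le
    (Finset.sum_nonneg fun j _ => mul_nonneg (hA i j) (hy j).le))
    (mul_pos (gmean_pos hx) (gmean_pos hy)).le

lemma dotProduct_mulVec_eq_sum (A : Matrix ι ι ℝ) (x y : ι → ℝ) :
    x ⬝ᵥ (A *ᵥ y) = ∑ i, ∑ j, A i j * x i * y j := by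
  simp only [dotProduct, Matrix.mulVec, Finset.mul_sum]
  exact Finset.sum_congr rfl fun i _ => Finset.sum_congr rfl fun j _ => by ring

lemma card_sq_mul_smean_mul_le [Nonempty ι] {A : Matrix ι ι ℝ} (hA : ∀ i j, 0 ≤ A i j)
    {x y : ι → ℝ} (hx : ∀ i, 0 < x i) (hy : ∀ j, 0 < y j) :
    (Fintype.card ι : ℝ) ^ 2 * smean A * (gmean x * gmean y) ≤ ∑ i, ∑ j, A i j * x i * y j := by
  have hn : (Fintype.card ι : ℝ) ≠ 0 := by exact_mod_cast Fintype.card_ne_zero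
  have hg := mul_pos (gmean_pos hx) (gmean_pos hy)
  rw [← dotProduct_mulVec_eq_sum, ← le_div_iff₀ hg, smean, ← mul_assoc,
    show (Fintype.card ι : ℝ) ^ 2 * (1 / (Fintype.card ι * Fintype.card ι)) = 1 by field_simp,
    one_mul]
  refine csInf_le ⟨0, ?_⟩ ⟨x, y, hx, hy, rfl⟩
  rintro _ ⟨x, y, hx, hy, rfl⟩
  refine div_nonneg (Finset.sum_nonneg fun i _ => mul_nonneg (hx i).le
    (Finset.sum_nonneg fun j _ => mul_nonneg (hA i j) (hy j).le))
    (mul_pos (gmean_pos hx) (gmean_pos hy)).le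

lemma le_smean [Nonempty ι] {A : Matrix ι ι ℝ} {b : ℝ}
    (h : ∀ x y : ι → ℝ, (∀ i, 0 < x i) → (∀ j, 0 < y j) →
      b * (Fintype.card ι : ℝ) ^ 2 ≤ (x ⬝ᵥ (A *ᵥ y)) / (gmean x * gmean y)) : b ≤ smean A := by
  have hn : (0 : ℝ) < Fintype.card ι := by exact_mod_cast Fintype.card_pos
  rw [smean, ← sq, one_div, inv_mul_eq_div, le_div_iff₀ (by positivity)]
  refine le_csInf ⟨_, fun _ => 1, fun _ => 1, fun _ => one_pos, fun _ => one_pos, rfl⟩ ?_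
  rintro _ ⟨x, y, hx, hy, rfl⟩
  exact h x y hx hy

/-- AM-GM for the numbers `x i * (A *ᵥ y) i`, whose sum is the bilinear form. -/
lemma prod_mulVec_le [Nonempty ι] {A : Matrix ι ι ℝ} (hA : ∀ i j, 0 ≤ A i j)
    {x y : ι → ℝ} (hx : ∀ i, 0 < x i) (hy : ∀ j, 0 < y j) :
    ∏ i, (A *ᵥ y) i ≤
      ((x ⬝ᵥ (A *ᵥ y)) / (gmean x * gmean y) / Fintype.card ι) ^ Fintype.card ι * ∏ j, y j := by
  have hn : (0 : ℝ) < Fintype.card ι := by exact_mod_cast Fintype.card_pos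
  have hgx := gmean_pos hx
  have hgy := gmean_pos hy
  have hAy : ∀ i, 0 ≤ (A *ᵥ y) i := fun i =>
    Finset.sum_nonneg fun j _ => mul_nonneg (hA i j) (hy j).le
  have hxAy : ∀ i, 0 ≤ x i * (A *ᵥ y) i := fun i => mul_nonneg (hx i).le (hAy i)
  have h := card_mul_gmean_le_sum hxAy
  have hp : gmean (fun i => x i * (A *ᵥ y) i) ^ Fintype.card ι =
      (∏ i, x i) * ∏ i, (A *ᵥ y) i := by
    rw [gmean, one_div, Real.rpow_inv_natCast_pow (Finset.prod_nonneg fun i _ => hxAy i)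
      Fintype.card_ne_zero, Finset.prod_mul_distrib]
  have h0 : 0 ≤ gmean (fun i => x i * (A *ᵥ y) i) :=
    Real.rpow_nonneg (Finset.prod_nonneg fun i _ => hxAy i) _
  rw [← gmean_pow hy, ← mul_pow]
  have h2 : gmean (fun i => x i * (A *ᵥ y) i) / gmean x ≤
      (x ⬝ᵥ (A *ᵥ y)) / (gmean x * gmean y) / Fintype.card ι * gmean y := by
    rw [show (x ⬝ᵥ (A *ᵥ y)) / (gmean x * gmean y) / Fintype.card ι * gmean y =
      (x ⬝ᵥ (A *ᵥ y)) / Fintype.card ι / gmean x by field_simp]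
    refine div_le_div_of_nonneg_right ?_ hgx.le
    rw [le_div_iff₀ hn, mul_comm]
    exact h
  refine le_trans (le_of_eq ?_) (pow_le_pow_left₀ (div_nonneg h0 hgx.le) h2 _)
  rw [div_pow, hp, gmean_pow hx, mul_div_cancel_left₀]
  exact (Finset.prod_pos fun i _ => hx i).ne'

variable [DecidableEq ι]

/-- Hall's theorem gives rows `s` with fewer than `s.card` neighbouring columns. Scaling these rows
up and those columns down keeps the form bounded while the geometric means blow up. -/
lemma smean_eq_zero_of_forall_perm [Nonempty ι] {A : Matrix ι ι ℝ} (hA : ∀ i j, 0 ≤ A i j)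
    (h : ¬ ∃ τ : Equiv.Perm ι, ∀ i, 0 < A i (τ i)) : smean A = 0 := by
  classical
  refine le_antisymm ?_ (smean_nonneg hA)
  let t : ι → Finset ι := fun i => Finset.univ.filter fun j => 0 < A i j
  have hhall : ¬ ∀ s : Finset ι, s.card ≤ (s.biUnion t).card := by
    rw [Finset.all_card_le_biUnion_card_iff_exists_injective]
    rintro ⟨f, hf, hft⟩
    refine h ⟨Equiv.ofBijective f (Finite.injective_iff_bijective.1 hf), fun i => ?_⟩
    exact (Finset.mem_filter.1 (hft i)).2
  push Not at hhall
  obtain ⟨s, hs⟩ := hhall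
  have hn : (0 : ℝ) < Fintype.card ι := by exact_mod_cast Fintype.card_pos
  set C := ∑ i, ∑ j, A i j with hC
  have hC0 : 0 ≤ C := Finset.sum_nonneg fun i _ => Finset.sum_nonneg fun j _ => hA i j
  have key : ∀ T : ℝ, 1 ≤ T → (Fintype.card ι : ℝ) ^ 2 * smean A * T ≤ C := by
    intro T hT
    have hT0 : 0 < T := one_pos.trans_le hT
    have hTn : 1 ≤ T ^ Fintype.card ι := one_le_pow₀ hT
    -- The exponent `card ι` cancels the root in `gmean`, so a deficit of one column already gains a
    -- factor `T`.
    set x : ι → ℝ := fun i => if i ∈ s then T ^ Fintype.card ι else 1 with hx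
    set y : ι → ℝ := fun j => if j ∈ s.biUnion t then (T ^ Fintype.card ι)⁻¹ else 1 with hy
    have hx0 : ∀ i, 0 < x i := fun i => by simp only [hx]; split_ifs <;> positivity
    have hy0 : ∀ i, 0 < y i := fun i => by simp only [hy]; split_ifs <;> positivity
    have hle := card_sq_mul_smean_mul_le hA hx0 hy0
    have hg : T ≤ gmean x * gmean y := by
      refine le_of_pow_le_pow_left₀ (n := Fintype.card ι) Fintype.card_ne_zero
        (mul_pos (gmean_pos hx0) (gmean_pos hy0)).le ?_
      rw [mul_pow, gmean_pow hx0, gmean_pow hy0]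
      have h1 : ∏ i, x i = (T ^ Fintype.card ι) ^ s.card := by
        simp [hx, Finset.prod_ite_mem]
      have h2 : ∏ i, y i = ((T ^ Fintype.card ι) ^ (s.biUnion t).card)⁻¹ := by
        simp only [hy]
        rw [Finset.prod_ite_mem, Finset.univ_inter, Finset.prod_const, inv_pow]
      rw [h1, h2, ← div_eq_mul_inv, le_div_iff₀ (by positivity), ← pow_succ']
      exact pow_le_pow_right₀ hTn hs
    refine le_trans (mul_le_mul_of_nonneg_left hg
      (mul_nonneg (by positivity) (smean_nonneg hA))) (hle.trans ?_)
    refine Finset.sum_le_sum fun i _ => Finset.sum_le_sum fun j _ => ?_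
    rw [mul_assoc]
    rcases (hA i j).eq_or_lt with h0 | h0
    · simp [← h0]
    refine mul_le_of_le_one_right h0.le ?_
    have hinv : (T ^ Fintype.card ι)⁻¹ ≤ 1 := inv_le_one_of_one_le₀ hTn
    by_cases hi : i ∈ s
    · have hj : j ∈ s.biUnion t :=
        Finset.mem_biUnion.2 ⟨i, hi, Finset.mem_filter.2 ⟨Finset.mem_univ j, h0⟩⟩
      simp only [hx, hy, if_pos hi, if_pos hj]
      rw [mul_inv_cancel₀ (by positivity)]
    · simp only [hx, hy, if_neg hi, one_mul]
      split_ifs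
      · exact hinv
      · exact le_rfl
  by_contra hlt
  push Not at hlt
  have hpos : 0 < (Fintype.card ι : ℝ) ^ 2 * smean A := by positivity
  have := key (1 + C / ((Fintype.card ι : ℝ) ^ 2 * smean A)) (by
    have : 0 ≤ C / ((Fintype.card ι : ℝ) ^ 2 * smean A) := by positivity
    linarith)
  rw [mul_add, mul_one, mul_div_cancel₀ _ hpos.ne'] at this
  linarith

lemma pmean_le_of_le_pow [Nonempty ι] {B : Matrix ι ι ℝ} {b : ℝ} (hB : 0 ≤ B.permanent) (hb : 0 ≤ b)
    (h : B.permanent ≤ b ^ Fintype.card ι * (Fintype.card ι)!) : pmean B ≤ b := by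
  rw [pmean, one_div, ← Real.pow_rpow_inv_natCast hb (n := Fintype.card ι) Fintype.card_ne_zero]
  refine Real.rpow_le_rpow (by positivity) ?_ (by positivity)
  rwa [div_le_iff₀ (by positivity)]

lemma le_pmean_of_pow_le [Nonempty ι] {B : Matrix ι ι ℝ} {b : ℝ} (hb : 0 ≤ b)
    (h : b ^ Fintype.card ι * (Fintype.card ι)! ≤ B.permanent) : b ≤ pmean B := by
  rw [pmean, one_div, ← Real.pow_rpow_inv_natCast hb (n := Fintype.card ι) Fintype.card_ne_zero]
  refine Real.rpow_le_rpow (by positivity) ?_ (by positivity)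
  rwa [le_div_iff₀ (by positivity)]

end means

open Filter Topology

/-! ### Bounds for a fixed block size -/

section bounds
variable {ι κ : Type*} [Fintype ι] [Fintype κ]

lemma prod_prod_pow_mul {m : ℕ} {K : ι → ι → ℕ} (hK : K ∈ lineSumMatrices ι m) (x y : ι → ℝ) :
    ∏ i, ∏ j, (x i * y j) ^ K i j = ((∏ i, x i) * ∏ j, y j) ^ m := by
  simp only [mul_pow, Finset.prod_mul_distrib]
  rw [Finset.prod_comm (f := fun i j => y j ^ K i j)]
  simp only [Finset.prod_pow_eq_pow_sum, hK.1, hK.2, Finset.prod_pow]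

/-- Raise the entrywise bound to the power `K i j`; constant line sums collect the scaling factors
into one `m`-th power. -/
lemma le_multiplicityWeight {A : Matrix ι ι ℝ} {m : ℕ} {K : ι → ι → ℕ}
    (hK : K ∈ lineSumMatrices ι m) {x y : ι → ℝ}
    (h : ∀ i j, (K i j : ℝ) ≤ A i j * x i * y j) :
    ∏ i, ∏ j, (K i j : ℝ) ^ K i j / (K i j)! ≤
      multiplicityWeight A K * ((∏ i, x i) * ∏ j, y j) ^ m := by
  rw [← prod_prod_pow_mul hK, multiplicityWeight]
  simp only [← Finset.prod_mul_distrib]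
  refine Finset.prod_le_prod (fun i _ => Finset.prod_nonneg fun j _ => by positivity) fun i _ =>
    Finset.prod_le_prod (fun j _ => by positivity) fun j _ => ?_
  rw [div_mul_eq_mul_div, ← mul_pow, ← mul_assoc]
  exact div_le_div_of_nonneg_right (pow_le_pow_left₀ (by positivity) (h i j) _) (by positivity)

lemma exp_pow_le_prod {m : ℕ} {K : ι → ι → ℕ} (hK : K ∈ lineSumMatrices ι m) :
    Real.exp 1 ^ (Fintype.card ι * m) ≤
      (∏ i, ∏ j, (K i j : ℝ) ^ K i j / (K i j)!) *
        (Real.exp 1 * (m + 1)) ^ (Fintype.card ι ^ 2) := by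
  have he := Real.exp_pos 1
  have h1 : ∀ i j, Real.exp 1 ^ K i j ≤
      (K i j : ℝ) ^ K i j / (K i j)! * (Real.exp 1 * (m + 1)) := by
    intro i j
    have h := factorial_mul_exp_le (K i j)
    have hle : (K i j : ℝ) ≤ m := by
      rw [← hK.1 i]
      exact_mod_cast Finset.single_le_sum (f := K i) (fun _ _ => Nat.zero_le _) (Finset.mem_univ j)
    rw [div_mul_eq_mul_div, le_div_iff₀ (by positivity), mul_comm]
    refine h.trans ?_
    rw [mul_comm]
    gcongr
  have h2 : Real.exp 1 ^ (Fintype.card ι * m) = ∏ i, ∏ j, Real.exp 1 ^ K i j := by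
    simp only [Finset.prod_pow_eq_pow_sum, hK.1]
    simp
  rw [h2]
  refine (Finset.prod_le_prod (fun i _ => Finset.prod_nonneg fun j _ => by positivity) fun i _ =>
    Finset.prod_le_prod (fun j _ => by positivity) fun j _ => h1 i j).trans (le_of_eq ?_)
  simp only [Finset.prod_mul_distrib, Finset.prod_const, Finset.card_univ]
  rw [sq, pow_mul, mul_pow, mul_pow]

/-- Test the infimum on the scaling itself: the entries sum to at most `n * m + n ^ 2`. -/
lemma smean_pow_mul_prod_le [Nonempty ι] {A : Matrix ι ι ℝ} (hA : ∀ i j, 0 ≤ A i j) {m : ℕ}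
    {K : ι → ι → ℕ} (hK : K ∈ lineSumMatrices ι m) {x y : ι → ℝ} (hx : ∀ i, 0 < x i)
    (hy : ∀ j, 0 < y j) (h : ∀ i j, A i j * x i * y j ≤ K i j + 1) :
    (smean A * Fintype.card ι) ^ Fintype.card ι * ((∏ i, x i) * ∏ j, y j) ≤
      ((m : ℝ) + Fintype.card ι) ^ Fintype.card ι := by
  have hn : (0 : ℝ) < Fintype.card ι := by exact_mod_cast Fintype.card_pos
  rw [← gmean_pow hx, ← gmean_pow hy, ← mul_pow, ← mul_pow]
  have hg := mul_pos (gmean_pos hx) (gmean_pos hy)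
  refine pow_le_pow_left₀ (mul_nonneg (mul_nonneg (smean_nonneg hA) hn.le) hg.le) ?_ _
  refine le_of_mul_le_mul_left ?_ hn
  calc (Fintype.card ι : ℝ) * (smean A * Fintype.card ι * (gmean x * gmean y))
      = (Fintype.card ι : ℝ) ^ 2 * smean A * (gmean x * gmean y) := by ring
    _ ≤ ∑ i, ∑ j, A i j * x i * y j := card_sq_mul_smean_mul_le hA hx hy
    _ ≤ ∑ i, ∑ j, ((K i j : ℝ) + 1) :=
      Finset.sum_le_sum fun i _ => Finset.sum_le_sum fun j _ => h i j
    _ = _ := by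
      have h1 : ∀ i, ∑ j, (K i j : ℝ) = m := fun i => by exact_mod_cast hK.1 i
      simp [Finset.sum_add_distrib, h1]
      ring

variable [DecidableEq ι] [DecidableEq κ]

lemma permanent_kronecker_ones_nonneg {A : Matrix ι ι ℝ} (hA : ∀ i j, 0 ≤ A i j)
    {J : Matrix κ κ ℝ} (hJ : ∀ s t, J s t = 1) : 0 ≤ (A ⊗ₖ J).permanent := by
  rw [permanent_kronecker_ones A J hJ]
  exact Finset.sum_nonneg fun π _ => Finset.prod_nonneg fun p _ => hA _ _

variable [Nonempty ι] [Nonempty κ]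

theorem pmean_kronecker_ones_le {A : Matrix ι ι ℝ} (hA : ∀ i j, 0 ≤ A i j)
    {J : Matrix κ κ ℝ} (hJ : ∀ s t, J s t = 1) {E : ℝ} (hE : 0 < E)
    (hEpow : (Real.exp 1 * (Fintype.card κ + 1)) ≤ E ^ Fintype.card κ) :
    pmean (A ⊗ₖ J) ≤ smean A * E := by
  have hn : (0 : ℝ) < Fintype.card ι := by exact_mod_cast Fintype.card_pos
  rw [← div_le_iff₀ hE]
  refine le_smean fun x y hx hy => ?_
  set r := (x ⬝ᵥ (A *ᵥ y)) / (gmean x * gmean y) with hr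
  have hr0 : 0 ≤ r := div_nonneg (Finset.sum_nonneg fun i _ => mul_nonneg (hx i).le
    (Finset.sum_nonneg fun j _ => mul_nonneg (hA i j) (hy j).le))
    (mul_pos (gmean_pos hx) (gmean_pos hy)).le
  rw [← le_div_iff₀ (by positivity), div_le_iff₀ hE]
  refine pmean_le_of_le_pow (permanent_kronecker_ones_nonneg hA hJ) (by positivity) ?_
  rw [Fintype.card_prod]
  set n := Fintype.card ι with hn'
  set m := Fintype.card κ with hm'
  have hP : 0 < ∏ j, y j := Finset.prod_pos fun j _ => hy j
  have hAy : ∀ i, 0 ≤ (A *ᵥ y) i := fun i =>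
    Finset.sum_nonneg fun j _ => mul_nonneg (hA i j) (hy j).le
  have h1 : (A ⊗ₖ J).permanent ≤ (m ! : ℝ) ^ n * (r / n) ^ (n * m) := by
    refine le_of_mul_le_mul_right ((permanent_kronecker_ones_le hA hJ hy).trans ?_) (pow_pos hP m)
    rw [mul_assoc, pow_mul, ← mul_pow]
    refine mul_le_mul_of_nonneg_left (pow_le_pow_left₀
      (Finset.prod_nonneg fun i _ => hAy i) ?_ _) (by positivity)
    exact prod_mulVec_le hA hx hy
  have he := Real.exp_pos 1
  -- `E` absorbs the polynomial factor of the upper Stirling bound for `m!`; the lower bound for `(n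
  -- * m)!` loses nothing.
  have h2 : (m ! : ℝ) ^ n * Real.exp 1 ^ (n * m) ≤ E ^ (n * m) * (m : ℝ) ^ (n * m) := by
    rw [mul_comm n m, pow_mul, pow_mul, pow_mul, ← mul_pow, ← mul_pow]
    refine pow_le_pow_left₀ (by positivity) ((factorial_mul_exp_le m).trans ?_) n
    gcongr
  have h3 := pow_le_factorial_mul_exp (n * m)
  push_cast at h3
  rw [mul_pow (n : ℝ)] at h3
  refine h1.trans ?_
  refine le_of_mul_le_mul_right ?_ (pow_pos he (n * m))
  calc (m ! : ℝ) ^ n * (r / n) ^ (n * m) * Real.exp 1 ^ (n * m)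
      = ((m ! : ℝ) ^ n * Real.exp 1 ^ (n * m)) * (r / n) ^ (n * m) := by ring
    _ ≤ (E ^ (n * m) * (m : ℝ) ^ (n * m)) * (r / n) ^ (n * m) := by gcongr
    _ = (r / n ^ 2 * E) ^ (n * m) * ((n : ℝ) ^ (n * m) * (m : ℝ) ^ (n * m)) := by
      rw [← mul_pow, ← mul_pow, ← mul_pow, ← mul_pow]
      congr 1
      field_simp
    _ ≤ (r / n ^ 2 * E) ^ (n * m) * ((n * m)! * Real.exp 1 ^ (n * m)) := by gcongr
    _ = _ := by ring

/-- The factor `m / (m + n)` pays for the rounding by 1. In `hFpow`, `n ^ 2` factors come from the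
entries of `K`, and the last one, with `n`, from Stirling for `(n * m)!`. -/
theorem le_pmean_kronecker_ones {A : Matrix ι ι ℝ} (hA : ∀ i j, 0 ≤ A i j)
    {J : Matrix κ κ ℝ} (hJ : ∀ s t, J s t = 1) {τ : Equiv.Perm ι} (hτ : ∀ i, 0 < A i (τ i))
    {F : ℝ} (hF : 0 < F)
    (hFpow : Fintype.card ι * (Real.exp 1 * (Fintype.card κ + 1)) ^ (Fintype.card ι ^ 2 + 1) ≤
      F ^ (Fintype.card ι * Fintype.card κ)) :
    smean A * (Fintype.card κ / (Fintype.card κ + Fintype.card ι)) / F ≤ pmean (A ⊗ₖ J) := by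
  have hn : (0 : ℝ) < Fintype.card ι := by exact_mod_cast Fintype.card_pos
  have hm : (0 : ℝ) < Fintype.card κ := by exact_mod_cast Fintype.card_pos
  obtain ⟨K, hK, hpos, hmax⟩ := exists_isMaxOn_multiplicityWeight hτ (Fintype.card κ)
  obtain ⟨x, y, hx, hy, hxy⟩ := exists_scaling hA Fintype.card_pos hK hpos hmax
  obtain ⟨π, hπ⟩ := exists_perm_blockCount_eq hK.1 hK.2
  have hper := le_permanent_kronecker_ones_of_perm hA hJ π
  simp only [hπ] at hper
  change _ * multiplicityWeight A K ≤ _ at hper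
  have hw := le_multiplicityWeight hK fun i j => (hxy i j).1
  have hs := smean_pow_mul_prod_le hA hK hx hy fun i j => (hxy i j).2
  have hexp := exp_pow_le_prod hK
  have hs0 := smean_nonneg hA
  refine le_pmean_of_pow_le (by positivity) (le_trans ?_ hper)
  rw [Fintype.card_prod]
  set n := Fintype.card ι
  set m := Fintype.card κ
  set w := multiplicityWeight A K
  set P := (∏ i, x i) * ∏ j, y j
  have hP : 0 < P := mul_pos (Finset.prod_pos fun i _ => hx i) (Finset.prod_pos fun j _ => hy j)
  set s := smean A
  set e := Real.exp 1
  have he : 0 < e := Real.exp_pos 1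
  have hs' : (s * n) ^ (n * m) * P ^ m ≤ ((m : ℝ) + n) ^ (n * m) := by
    rw [pow_mul, ← mul_pow, pow_mul]
    exact pow_le_pow_left₀ (by positivity) hs m
  have hfac : (m : ℝ) ^ (n * m) ≤ (m ! : ℝ) ^ n * e ^ (n * m) := by
    rw [mul_comm n m, pow_mul, pow_mul, ← mul_pow]
    exact pow_le_pow_left₀ (by positivity) (pow_le_factorial_mul_exp m) n
  have hfacN : ((n * m)! : ℝ) * e ^ (n * m) ≤
      n * (e * (m + 1)) * ((n : ℝ) ^ (n * m) * (m : ℝ) ^ (n * m)) := by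
    have h := factorial_mul_exp_le (n * m)
    push_cast at h
    rw [mul_pow (n : ℝ)] at h
    refine h.trans (mul_le_mul_of_nonneg_right ?_ (by positivity))
    have h1 : (1 : ℝ) ≤ n := by exact_mod_cast Fintype.card_pos
    nlinarith
  have hexp' : e ^ (n * m) ≤ w * P ^ m * (e * (m + 1)) ^ (n ^ 2) :=
    hexp.trans (mul_le_mul_of_nonneg_right hw (by positivity))
  have hw0 : 0 ≤ w := hpos.le
  rw [div_pow, mul_pow, div_pow]
  have hc : 0 < P ^ m * (e ^ (n * m) * e ^ (n * m)) * (n : ℝ) ^ (n * m) := by positivity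
  refine le_of_mul_le_mul_right ?_ hc
  have hFN : (n : ℝ) * (e * (m + 1)) * (e * (m + 1)) ^ n ^ 2 ≤ F ^ (n * m) := by
    refine le_of_eq_of_le ?_ hFpow
    ring
  calc s ^ (n * m) * ((m : ℝ) ^ (n * m) / (m + n) ^ (n * m)) / F ^ (n * m) * ((n * m)! : ℝ) *
        (P ^ m * (e ^ (n * m) * e ^ (n * m)) * (n : ℝ) ^ (n * m))
      = ((s * n) ^ (n * m) * P ^ m) * ((m : ℝ) ^ (n * m) / (m + n) ^ (n * m)) / F ^ (n * m) *
        (((n * m)! : ℝ) * e ^ (n * m)) * e ^ (n * m) := by rw [mul_pow s]; ring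
    _ ≤ (((m : ℝ) + n) ^ (n * m)) * ((m : ℝ) ^ (n * m) / (m + n) ^ (n * m)) / F ^ (n * m) *
        (n * (e * (m + 1)) * ((n : ℝ) ^ (n * m) * (m : ℝ) ^ (n * m))) *
        (w * P ^ m * (e * (m + 1)) ^ (n ^ 2)) := by gcongr
    _ = (m : ℝ) ^ (n * m) * (m : ℝ) ^ (n * m) * (w * P ^ m * (n : ℝ) ^ (n * m)) *
        ((n * (e * (m + 1)) * (e * (m + 1)) ^ (n ^ 2)) / F ^ (n * m)) := by
      field_simp
    _ ≤ ((m ! : ℝ) ^ n * e ^ (n * m)) * ((m ! : ℝ) ^ n * e ^ (n * m)) *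
        (w * P ^ m * (n : ℝ) ^ (n * m)) * 1 := by
      have := (div_le_one (by positivity)).2 hFN
      gcongr
    _ = _ := by ring

end bounds

/-! ### Error factors and the limit -/

lemma tendsto_one_add_log_div :
    Tendsto (fun m : ℕ => (1 + Real.log ((m : ℝ) + 1)) / m) atTop (𝓝 0) := by
  have h1 : Tendsto (fun m : ℕ => Real.log ((m : ℝ) + 1) / ((m : ℝ) + 1)) atTop (𝓝 0) := by
    have h := (Real.isLittleO_log_id_atTop).tendsto_div_nhds_zero
    exact h.comp (tendsto_atTop_add_const_right _ _ tendsto_natCast_atTop_atTop)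
  have h2 : Tendsto (fun m : ℕ => 1 + 1 / (m : ℝ)) atTop (𝓝 (1 + 0)) :=
    tendsto_const_nhds.add tendsto_one_div_atTop_nhds_zero_nat
  have h3 := tendsto_one_div_atTop_nhds_zero_nat (𝕜 := ℝ) |>.add (h1.mul h2)
  rw [zero_mul, zero_add] at h3
  refine h3.congr' ?_
  filter_upwards [eventually_gt_atTop 0] with m hm
  have : (0 : ℝ) < m := by exact_mod_cast hm
  field_simp

/-- A bound for the ratio of the permanental mean of `A ⊗ₖ allOnes m` to the scaling mean. -/
noncomputable def upperFactor (m : ℕ) : ℝ := Real.exp ((1 + Real.log ((m : ℝ) + 1)) / m)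

/-- A bound for the ratio of the scaling mean of `A` to the permanental mean. -/
noncomputable def lowerFactor (n m : ℕ) : ℝ :=
  Real.exp (Real.log n / n * (1 / m) + (n ^ 2 + 1) / n * ((1 + Real.log ((m : ℝ) + 1)) / m))

lemma exp_one_add_log {m : ℕ} :
    Real.exp (1 + Real.log ((m : ℝ) + 1)) = Real.exp 1 * (m + 1) := by
  rw [Real.exp_add, Real.exp_log (by positivity)]

lemma upperFactor_pow {m : ℕ} (hm : 0 < m) : upperFactor m ^ m = Real.exp 1 * (m + 1) := by
  have : (m : ℝ) ≠ 0 := by exact_mod_cast hm.ne'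
  rw [upperFactor, ← Real.exp_nat_mul, mul_div_cancel₀ _ this, exp_one_add_log]

lemma lowerFactor_pow {n m : ℕ} (hn : 0 < n) (hm : 0 < m) :
    lowerFactor n m ^ (n * m) = n * (Real.exp 1 * (m + 1)) ^ (n ^ 2 + 1) := by
  have hm' : (m : ℝ) ≠ 0 := by exact_mod_cast hm.ne'
  have hn' : (n : ℝ) ≠ 0 := by exact_mod_cast hn.ne'
  rw [lowerFactor, ← Real.exp_nat_mul, ← exp_one_add_log, ← Real.exp_nat_mul]
  conv_rhs => rw [← Real.exp_log (show (0 : ℝ) < n by exact_mod_cast hn)]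
  rw [← Real.exp_add]
  congr 1
  push_cast
  field_simp

lemma tendsto_upperFactor : Tendsto upperFactor atTop (𝓝 1) := by
  have h := (Real.continuous_exp.tendsto 0).comp tendsto_one_add_log_div
  rwa [Real.exp_zero] at h

lemma tendsto_lowerFactor (n : ℕ) : Tendsto (lowerFactor n) atTop (𝓝 1) := by
  have h1 := (tendsto_one_div_atTop_nhds_zero_nat (𝕜 := ℝ)).const_mul (Real.log n / n)
  have h2 := tendsto_one_add_log_div.const_mul (((n : ℝ) ^ 2 + 1) / n)
  have h3 := h1.add h2
  rw [mul_zero, mul_zero, add_zero] at h3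
  have h := (Real.continuous_exp.tendsto 0).comp h3
  rwa [Real.exp_zero] at h

end MatrixMean

theorem theorem2p11 (n : ℕ) (hn : 1 ≤ n) (A : Matrix (Fin n) (Fin n) ℝ)
    (hA : ∀ i j, 0 ≤ A i j) :
    Filter.Tendsto (fun m : ℕ => MatrixMean.pmean (A ⊗ₖ MatrixMean.allOnes m))
      Filter.atTop (nhds (MatrixMean.smean A)) := by
  open MatrixMean Filter in
  have : NeZero n := ⟨by omega⟩
  have hup : ∀ m : ℕ, 0 < m → pmean (A ⊗ₖ allOnes m) ≤ smean A * upperFactor m := fun m hm => by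
    have : NeZero m := ⟨hm.ne'⟩
    exact pmean_kronecker_ones_le hA (fun _ _ => rfl) (Real.exp_pos _)
      (by simpa using (upperFactor_pow hm).ge)
  have hupper : Tendsto (fun m => smean A * upperFactor m) atTop (nhds (smean A)) := by
    simpa using tendsto_upperFactor.const_mul (smean A)
  by_cases h : ∃ τ : Equiv.Perm (Fin n), ∀ i, 0 < A i (τ i)
  · obtain ⟨τ, hτ⟩ := h
    have hlow : ∀ m : ℕ, 0 < m →
        smean A * (m / (m + n)) / lowerFactor n m ≤ pmean (A ⊗ₖ allOnes m) := fun m hm => by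
      have : NeZero m := ⟨hm.ne'⟩
      simpa using le_pmean_kronecker_ones hA (J := allOnes m) (fun _ _ => rfl) hτ
        (F := lowerFactor n m) (Real.exp_pos _)
        (by simpa using (lowerFactor_pow (Nat.pos_of_neZero n) hm).ge)
    have hlower : Tendsto (fun m : ℕ => smean A * ((m : ℝ) / (m + n)) / lowerFactor n m) atTop
        (nhds (smean A)) := by
      have h := ((tendsto_natCast_div_add_atTop (n : ℝ)).const_mul (smean A)).div
        (tendsto_lowerFactor n) one_ne_zero
      rwa [mul_one, div_one] at h
    refine tendsto_of_tendsto_of_tendsto_of_le_of_le' hlower hupper ?_ ?_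
    · filter_upwards [eventually_gt_atTop 0] with m hm using hlow m hm
    · filter_upwards [eventually_gt_atTop 0] with m hm using hup m hm
  -- Without a positive diagonal the scaling mean is 0, so the squeeze is between 0 and the upper
  -- bound.
  · refine tendsto_of_tendsto_of_tendsto_of_le_of_le' (g := fun _ => 0) ?_ hupper
      (Eventually.of_forall fun m => ?_)
      (by filter_upwards [eventually_gt_atTop 0] with m hm using hup m hm)
    · rw [smean_eq_zero_of_forall_perm hA h]
      exact tendsto_const_nhds
    · exact Real.rpow_nonneg (div_nonneg
        (permanent_kronecker_ones_nonneg hA fun _ _ => rfl) (Nat.cast_nonneg _)) _
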